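/- Let $M$ be a finite-dimensional smooth manifold with a Riemannian or pseudo-Riemannian metric $g$ (a smooth nondegenerate symmetric bilinear form on $TM$, of any signature) and Levi-Civita connection $\nabla$; all functions and vector fields below are smooth. Then the following conditions are equivalent: (a) $M$ possesses a homothetic Euler vector field, i.e. a vector field $X$ with $\nabla_Y X = Y$ for every $Y \in TM$; (b) there exists a function $\kappa$ on $M$ such that $g = \nabla^2\kappa$, where $\nabla^2\kappa(Y,Z) = Y(Z\kappa) - (\nabla_Y Z)\kappa$ is the Hessian; (c) there exists a function $\kappa$ on $M$ whose gradient vector field $X$, defined by $\iota_X g = d\kappa$, satisfies $\mathcal{L}_X g = 2g$. Suppose in addition that $M$ is hyperkähler, that is, it carries three smooth almost complex structures $I_1, I_2, I_3$ with $I_iI_j = \sum_k \varepsilon_{ijk} I_k - \delta_{ij}$, $g(I_iY, I_iZ) = g(Y,Z)$ and $\nabla I_i = 0$, and let $\omega_i(Y,Z) = g(Y, I_iZ)$. Then (a), (b), (c) are also equivalent to each of the following: (d) there exists a function $\kappa$ on $M$ which is a common Kähler potential, i.e. $\omega_i = \tfrac12\, d(d\kappa\, I_i)$ for $i = 1,2,3$,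 where $(d\kappa\, I_i)(Y) = d\kappa(I_iY)$ and $d\alpha(Y,Z) = Y(\alpha(Z)) - Z(\alpha(Y)) - \alpha([Y,Z])$ for a 1-form $\alpha$; (e) there exist vector fields $X, X_1, X_2, X_3$ and a function $\kappa$ on $M$ such that, for all $i, j, k \in \{1,2,3\}$, $$\iota_{X_i}\omega_j = \sum_{l} \varepsilon_{ijl}\, \iota_X\omega_l - \delta_{ij}\, d\kappa \qquad\text{and}\qquad \mathcal{L}_X\omega_k = 2\omega_k .$$ -/

import Mathlib

open Bundle
open scoped Manifold ContDiff

noncomputable section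

namespace HomotheticEuler

/-- A vector field `X` on the manifold `M`, smooth as a section of the tangent bundle. -/
def SmoothField (E : Type*) [NormedAddCommGroup E] [NormedSpace ℝ E]
    {M : Type*} [TopologicalSpace M] [ChartedSpace E M] [IsManifold 𝓘(ℝ, E) ∞ M]
    (X : ∀ x : M, TangentSpace 𝓘(ℝ, E) x) : Prop :=
  ContMDiff 𝓘(ℝ, E) (𝓘(ℝ, E).prod 𝓘(ℝ, E)) ∞
    (fun x : M => TotalSpace.mk' E (E := TangentSpace 𝓘(ℝ, E)) x (X x))

/-- The vector field `X` is differentiable at the point `x`, as a section of the tangent bundle.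
As elsewhere in Mathlib, a first-order tensor identity is tested at a point `x` on all vector fields
differentiable at `x`; by tensoriality this says the same as testing it on smooth fields. -/
def DiffFieldAt (E : Type*) [NormedAddCommGroup E] [NormedSpace ℝ E]
    {M : Type*} [TopologicalSpace M] [ChartedSpace E M] [IsManifold 𝓘(ℝ, E) ∞ M]
    (X : ∀ x : M, TangentSpace 𝓘(ℝ, E) x) (x : M) : Prop :=
  MDifferentiableAt 𝓘(ℝ, E) (𝓘(ℝ, E).prod 𝓘(ℝ, E))
    (fun y : M => TotalSpace.mk' E (E := TangentSpace 𝓘(ℝ, E)) y (X y)) x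

/-- A pseudo-Riemannian metric on `M`: a smooth field of nondegenerate symmetric bilinear forms
(of arbitrary signature) on the tangent spaces. The Riemannian case is included. -/
structure PseudoMetric (E : Type*) [NormedAddCommGroup E] [NormedSpace ℝ E]
    (M : Type*) [TopologicalSpace M] [ChartedSpace E M] [IsManifold 𝓘(ℝ, E) ∞ M] where
  /-- The bilinear form at a point. -/
  form : ∀ x : M, TangentSpace 𝓘(ℝ, E) x →L[ℝ] TangentSpace 𝓘(ℝ, E) x →L[ℝ] ℝ
  symm : ∀ (x : M) (v w : TangentSpace 𝓘(ℝ, E) x), form x v w = form x w v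
  nondegenerate : ∀ (x : M) (v : TangentSpace 𝓘(ℝ, E) x), (∀ w, form x v w = 0) → v = 0
  contMDiff : ContMDiff 𝓘(ℝ, E) (𝓘(ℝ, E).prod 𝓘(ℝ, E →L[ℝ] E →L[ℝ] ℝ)) ∞
    (fun x : M => TotalSpace.mk' (E →L[ℝ] E →L[ℝ] ℝ)
      (E := fun y : M => TangentSpace 𝓘(ℝ, E) y →L[ℝ] TangentSpace 𝓘(ℝ, E) y →L[ℝ] ℝ) x (form x))

section

variable {E : Type*} [NormedAddCommGroup E] [NormedSpace ℝ E]
  {M : Type*} [TopologicalSpace M] [ChartedSpace E M] [IsManifold 𝓘(ℝ, E) ∞ M]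

/-- A connection on the tangent bundle is the Levi-Civita connection of `g` if it is torsion-free
and metric: `Y (g (Z, W)) = g (∇_Y Z, W) + g (Z, ∇_Y W)`.
In Mathlib's convention `cov Z x v` stands for `∇_v Z` at the point `x`. -/
structure IsLeviCivita [FiniteDimensional ℝ E] (g : PseudoMetric E M)
    (cov : CovariantDerivative 𝓘(ℝ, E) E (TangentSpace 𝓘(ℝ, E) : M → Type _)) : Prop where
  torsion_free : haveI : CompleteSpace E := FiniteDimensional.complete ℝ E
    cov.torsion = 0
  metric : ∀ (Z W : ∀ x : M, TangentSpace 𝓘(ℝ, E) x) (x : M),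
    DiffFieldAt E Z x → DiffFieldAt E W x → ∀ v : TangentSpace 𝓘(ℝ, E) x,
      mvfderiv 𝓘(ℝ, E) (fun y => g.form y (Z y) (W y)) x v =
        g.form x (cov Z x v) (W x) + g.form x (Z x) (cov W x v)

/-- `∇_v X = v` for every tangent vector `v`. -/
def IsHomotheticEuler
    (cov : CovariantDerivative 𝓘(ℝ, E) E (TangentSpace 𝓘(ℝ, E) : M → Type _))
    (X : ∀ x : M, TangentSpace 𝓘(ℝ, E) x) : Prop :=
  ∀ (x : M) (v : TangentSpace 𝓘(ℝ, E) x), cov X x v = v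

/-- The Hessian `(∇²κ)(Y, Z) = Y (Z κ) - (∇_Y Z) κ`. -/
def hessian (cov : CovariantDerivative 𝓘(ℝ, E) E (TangentSpace 𝓘(ℝ, E) : M → Type _))
    (κ : M → ℝ) (Y Z : ∀ x : M, TangentSpace 𝓘(ℝ, E) x) (x : M) : ℝ :=
  mvfderiv 𝓘(ℝ, E) (fun y => mvfderiv 𝓘(ℝ, E) κ y (Z y)) x (Y x)
    - mvfderiv 𝓘(ℝ, E) κ x (cov Z x (Y x))

/-- `X` is the gradient of `κ`, i.e. `ι_X g = dκ`. -/
def IsGradient (g : PseudoMetric E M) (κ : M → ℝ)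
    (X : ∀ x : M, TangentSpace 𝓘(ℝ, E) x) : Prop :=
  ∀ x : M, g.form x (X x) = mvfderiv 𝓘(ℝ, E) κ x

/-- The Lie derivative of a covariant 2-tensor,
`(L_X T)(Y, Z) = X (T (Y, Z)) - T ([X, Y], Z) - T (Y, [X, Z])`. -/
def lieDeriv (X : ∀ x : M, TangentSpace 𝓘(ℝ, E) x)
    (T : ∀ x : M, TangentSpace 𝓘(ℝ, E) x →L[ℝ] TangentSpace 𝓘(ℝ, E) x →L[ℝ] ℝ)
    (Y Z : ∀ x : M, TangentSpace 𝓘(ℝ, E) x) (x : M) : ℝ :=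
  mvfderiv 𝓘(ℝ, E) (fun y => T y (Y y) (Z y)) x (X x)
    - T x (VectorField.mlieBracket 𝓘(ℝ, E) X Y x) (Z x)
    - T x (Y x) (VectorField.mlieBracket 𝓘(ℝ, E) X Z x)

/-- `L_X T = 2 T`, tested on vector fields. -/
def LieDerivEqTwice (X : ∀ x : M, TangentSpace 𝓘(ℝ, E) x)
    (T : ∀ x : M, TangentSpace 𝓘(ℝ, E) x →L[ℝ] TangentSpace 𝓘(ℝ, E) x →L[ℝ] ℝ) : Prop :=
  ∀ (Y Z : ∀ x : M, TangentSpace 𝓘(ℝ, E) x) (x : M), DiffFieldAt E Y x → DiffFieldAt E Z x →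
    lieDeriv X T Y Z x = 2 * T x (Y x) (Z x)

/-- The exterior derivative of a 1-form, `(dα)(Y, Z) = Y (α Z) - Z (α Y) - α [Y, Z]`. -/
def extDerivOne (α : ∀ x : M, TangentSpace 𝓘(ℝ, E) x →L[ℝ] ℝ)
    (Y Z : ∀ x : M, TangentSpace 𝓘(ℝ, E) x) (x : M) : ℝ :=
  mvfderiv 𝓘(ℝ, E) (fun y => α y (Z y)) x (Y x)
    - mvfderiv 𝓘(ℝ, E) (fun y => α y (Y y)) x (Z x)
    - α x (VectorField.mlieBracket 𝓘(ℝ, E) Y Z x)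

end

/-- The totally antisymmetric symbol on three indices, with `epsilon 0 1 2 = 1`. -/
def epsilon (i j k : Fin 3) : ℝ :=
  if j = i + 1 ∧ k = i + 2 then 1 else if j = i + 2 ∧ k = i + 1 then -1 else 0

/-- The Kronecker symbol. -/
def delta (i j : Fin 3) : ℝ := if i = j then 1 else 0

/-- A (pseudo-)hyperkähler structure on a pseudo-Riemannian manifold with connection `cov`
(meant to be the Levi-Civita connection): three smooth parallel almost complex structures, which
form the algebra of imaginary quaternions and for which the metric is Hermitian. -/
structure Hyperkahler {E : Type*} [NormedAddCommGroup E] [NormedSpace ℝ E]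
    {M : Type*} [TopologicalSpace M] [ChartedSpace E M] [IsManifold 𝓘(ℝ, E) ∞ M]
    (g : PseudoMetric E M)
    (cov : CovariantDerivative 𝓘(ℝ, E) E (TangentSpace 𝓘(ℝ, E) : M → Type _)) where
  /-- The three almost complex structures. -/
  J : Fin 3 → ∀ x : M, TangentSpace 𝓘(ℝ, E) x →L[ℝ] TangentSpace 𝓘(ℝ, E) x
  contMDiff : ∀ i, ContMDiff 𝓘(ℝ, E) (𝓘(ℝ, E).prod 𝓘(ℝ, E →L[ℝ] E)) ∞
    (fun x : M => TotalSpace.mk' (E →L[ℝ] E)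
      (E := fun y : M => TangentSpace 𝓘(ℝ, E) y →L[ℝ] TangentSpace 𝓘(ℝ, E) y) x (J i x))
  /-- `I_i I_j = ε_ijk I_k - δ_ij`. -/
  quaternionic : ∀ (i j : Fin 3) (x : M) (v : TangentSpace 𝓘(ℝ, E) x),
    J i x (J j x v) = (∑ k, epsilon i j k • J k x v) - delta i j • v
  hermitian : ∀ (i : Fin 3) (x : M) (v w : TangentSpace 𝓘(ℝ, E) x),
    g.form x (J i x v) (J i x w) = g.form x v w
  /-- `∇ I_i = 0`, i.e. `∇_v (I_i Y) = I_i (∇_v Y)`. -/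
  parallel : ∀ (i : Fin 3) (Y : ∀ x : M, TangentSpace 𝓘(ℝ, E) x) (x : M), DiffFieldAt E Y x →
    ∀ v : TangentSpace 𝓘(ℝ, E) x, cov (fun y => J i y (Y y)) x v = J i x (cov Y x v)

section

variable {E : Type*} [NormedAddCommGroup E] [NormedSpace ℝ E]
  {M : Type*} [TopologicalSpace M] [ChartedSpace E M] [IsManifold 𝓘(ℝ, E) ∞ M]
  {g : PseudoMetric E M}
  {cov : CovariantDerivative 𝓘(ℝ, E) E (TangentSpace 𝓘(ℝ, E) : M → Type _)}

/-- The Kähler forms `ω_i (v, w) = g (v, I_i w)`. -/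
def Hyperkahler.omega (hk : Hyperkahler g cov) (i : Fin 3) (x : M) :
    TangentSpace 𝓘(ℝ, E) x →L[ℝ] TangentSpace 𝓘(ℝ, E) x →L[ℝ] ℝ :=
  (ContinuousLinearMap.precomp ℝ (hk.J i x)).comp (g.form x)

theorem Hyperkahler.omega_apply (hk : Hyperkahler g cov) (i : Fin 3) (x : M)
    (v w : TangentSpace 𝓘(ℝ, E) x) : hk.omega i x v w = g.form x v (hk.J i x w) := rfl

/-- `κ` is a potential for all three Kähler forms: `ω_i = ½ d(dκ ∘ I_i)` for every `i`. -/
def Hyperkahler.IsPotential (hk : Hyperkahler g cov) (κ : M → ℝ) : Prop :=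
  ∀ (i : Fin 3) (Y Z : ∀ x : M, TangentSpace 𝓘(ℝ, E) x) (x : M),
    DiffFieldAt E Y x → DiffFieldAt E Z x →
      hk.omega i x (Y x) (Z x) =
        (1 / 2 : ℝ) * extDerivOne (fun y => (mvfderiv 𝓘(ℝ, E) κ y).comp (hk.J i y)) Y Z x

end

end HomotheticEuler

end

/-!
Everything is expressed through the endomorphism `A = (v ↦ ∇_v X)` of the tangent spaces, where `X` is
the gradient of `κ`; each condition on `κ` says `A = id`.

A homothetic Euler field `X` is the gradient of `κ = ½ g (X, X)`, by metricity of the connection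
(`IsLeviCivita.isGradient_of_isHomotheticEuler`). Conversely every smooth `κ` has a smooth gradient
(`PseudoMetric.exists_isGradient`), so the first condition is equivalent to the existence of a pair
`(κ, X)` with `X = grad κ` and `A = id`, and it remains to read the other conditions in terms of `A`:

* the Hessian of `κ` is `g (A Y, Z)` (`IsLeviCivita.hessian_eq`). It is symmetric because the torsion
  vanishes and `[Y, Z] κ = Y (Z κ) - Z (Y κ)` (`mvfderiv_mlieBracket`), so `A` is self-adjoint;
* `L_X g` is `g (A Y, Z) + g (Y, A Z) = 2 g (A Y, Z)`;
* as `∇ I_i = 0`, both `d (dκ ∘ I_i)` and `L_X ω_i` are `g (A Y, I_i Z) - g (A Z, I_i Y)`. That these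
  equal `2 ω_i` for all three `i` forces `A = id`, by the quaternion relations
  (`Hyperkahler.eq_self_of_skew_eq`).

In the last condition, the contracted equations say that `X` is the gradient of `κ` and
`X_i = -I_i X`.
-/

noncomputable section

namespace HomotheticEuler

/-! ### Functions, vector fields and brackets in a chart -/

section Calculus

open VectorField

variable {E : Type*} [NormedAddCommGroup E] [NormedSpace ℝ E]
  {M : Type*} [TopologicalSpace M] [ChartedSpace E M] [IsManifold 𝓘(ℝ, E) ∞ M]

/-- `Z κ` is differentiable wherever `Z` is: it is the fibre component of the tangent map of `κ`
composed with `Z`. -/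
theorem DiffFieldAt.mdifferentiableAt_mvfderiv {κ : M → ℝ} (hκ : ContMDiff 𝓘(ℝ, E) 𝓘(ℝ, ℝ) ∞ κ)
    {Z : ∀ x : M, TangentSpace 𝓘(ℝ, E) x} {x : M} (hZ : DiffFieldAt E Z x) :
    MDifferentiableAt 𝓘(ℝ, E) 𝓘(ℝ, ℝ) (fun y => mvfderiv 𝓘(ℝ, E) κ y (Z y)) x := by
  have h1 : ContMDiff (𝓘(ℝ, E).tangent) (𝓘(ℝ, ℝ).tangent) 1 (tangentMap 𝓘(ℝ, E) 𝓘(ℝ, ℝ) κ) :=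
    hκ.contMDiff_tangentMap (by norm_cast)
  have h2 := contMDiff_snd_tangentBundle_modelSpace ℝ 𝓘(ℝ, ℝ) (n := 1)
  exact ((h2.comp h1).contMDiffAt.mdifferentiableAt one_ne_zero).comp x hZ

theorem contMDiffAt_mvfderiv_apply {κ : M → ℝ} (hκ : ContMDiff 𝓘(ℝ, E) 𝓘(ℝ, ℝ) ∞ κ)
    {Z : ∀ x : M, TangentSpace 𝓘(ℝ, E) x} {x : M}
    (hZ : ContMDiffAt 𝓘(ℝ, E) (𝓘(ℝ, E).prod 𝓘(ℝ, E)) ∞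
      (fun y : M => TotalSpace.mk' E (E := TangentSpace 𝓘(ℝ, E)) y (Z y)) x) :
    ContMDiffAt 𝓘(ℝ, E) 𝓘(ℝ, ℝ) ∞ (fun y => mvfderiv 𝓘(ℝ, E) κ y (Z y)) x := by
  have h1 : ContMDiff (𝓘(ℝ, E).tangent) (𝓘(ℝ, ℝ).tangent) ∞ (tangentMap 𝓘(ℝ, E) 𝓘(ℝ, ℝ) κ) :=
    hκ.contMDiff_tangentMap (by norm_cast)
  have h2 := contMDiff_snd_tangentBundle_modelSpace ℝ 𝓘(ℝ, ℝ) (n := ∞)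
  exact ((h2.comp h1).contMDiffAt).comp x hZ

/-- The derivative of a function along a vector field, read in a chart. -/
theorem fderiv_comp_extChartAt_symm {f : M → ℝ} (W : ∀ x : M, TangentSpace 𝓘(ℝ, E) x) {x : M}
    {e : E} (he : e ∈ (extChartAt 𝓘(ℝ, E) x).target)
    (hf : MDifferentiableAt 𝓘(ℝ, E) 𝓘(ℝ, ℝ) f ((extChartAt 𝓘(ℝ, E) x).symm e)) :
    fderiv ℝ (f ∘ (extChartAt 𝓘(ℝ, E) x).symm) e
        (mpullbackWithin 𝓘(ℝ, E) 𝓘(ℝ, E) (extChartAt 𝓘(ℝ, E) x).symm W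
          (Set.range 𝓘(ℝ, E)) e) =
      mvfderiv 𝓘(ℝ, E) f ((extChartAt 𝓘(ℝ, E) x).symm e) (W ((extChartAt 𝓘(ℝ, E) x).symm e)) := by
  have hinv := isInvertible_mfderivWithin_extChartAt_symm (I := 𝓘(ℝ, E)) he
  have hψ : MDifferentiableAt 𝓘(ℝ, E) 𝓘(ℝ, E) (extChartAt 𝓘(ℝ, E) x).symm e := by
    have := mdifferentiableWithinAt_extChartAt_symm (I := 𝓘(ℝ, E)) he
    simpa [mdifferentiableWithinAt_univ] using this
  have hrange : mfderiv 𝓘(ℝ, E) 𝓘(ℝ, E) (extChartAt 𝓘(ℝ, E) x).symm e =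
      mfderivWithin 𝓘(ℝ, E) 𝓘(ℝ, E) (extChartAt 𝓘(ℝ, E) x).symm (Set.range 𝓘(ℝ, E)) e := by
    rw [ModelWithCorners.range_eq_univ, mfderivWithin_univ]
  have h := mvfderiv_comp_apply (I := 𝓘(ℝ, E)) (I' := 𝓘(ℝ, E)) (g := f) e hf hψ
    (mpullbackWithin 𝓘(ℝ, E) 𝓘(ℝ, E) (extChartAt 𝓘(ℝ, E) x).symm W
      (Set.range 𝓘(ℝ, E)) e)
  rw [hrange, mpullbackWithin_apply, hinv.self_apply_inverse] at h
  rw [← h, mpullbackWithin_apply, mvfderiv, mfderiv_eq_fderiv]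
  rfl

/-- The Lie bracket acts on functions as a commutator, `[Y, Z] κ = Y (Z κ) - Z (Y κ)`. The fields
only have to be differentiable at the point, so this is computed in the chart there, where it reduces to
the symmetry of the second derivative. -/
theorem mvfderiv_mlieBracket [CompleteSpace E] {κ : M → ℝ} (hκ : ContMDiff 𝓘(ℝ, E) 𝓘(ℝ, ℝ) ∞ κ)
    {Y Z : ∀ x : M, TangentSpace 𝓘(ℝ, E) x} {x : M}
    (hY : DiffFieldAt E Y x) (hZ : DiffFieldAt E Z x) :
    mvfderiv 𝓘(ℝ, E) κ x (mlieBracket 𝓘(ℝ, E) Y Z x) =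
      mvfderiv 𝓘(ℝ, E) (fun y => mvfderiv 𝓘(ℝ, E) κ y (Z y)) x (Y x) -
        mvfderiv 𝓘(ℝ, E) (fun y => mvfderiv 𝓘(ℝ, E) κ y (Y y)) x (Z x) := by
  set φ := extChartAt 𝓘(ℝ, E) x with hφ
  set a := φ x with ha
  have hat : a ∈ φ.target := mem_extChartAt_target x
  have hψa : φ.symm a = x := extChartAt_to_inv x
  let pb : (∀ x : M, TangentSpace 𝓘(ℝ, E) x) → E → E := fun W =>
    mpullbackWithin 𝓘(ℝ, E) 𝓘(ℝ, E) φ.symm W (Set.range 𝓘(ℝ, E))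
  have hκd : MDifferentiable 𝓘(ℝ, E) 𝓘(ℝ, ℝ) κ := hκ.mdifferentiable (by simp)
  have hk : ContDiffAt ℝ ∞ (κ ∘ φ.symm) a := by
    have h1 : ContMDiffAt 𝓘(ℝ, E) 𝓘(ℝ, E) ∞ φ.symm a :=
      (contMDiffOn_extChartAt_symm x).contMDiffAt ((isOpen_extChartAt_target x).mem_nhds hat)
    exact (hκ.contMDiffAt.comp a h1).contDiffAt
  have hdk : DifferentiableAt ℝ (fderiv ℝ (κ ∘ φ.symm)) a :=
    (hk.fderiv_right (m := 1) (by norm_cast)).differentiableAt one_ne_zero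
  have hpbd : ∀ {W : ∀ x : M, TangentSpace 𝓘(ℝ, E) x}, DiffFieldAt E W x →
      DifferentiableAt ℝ (pb W) a := by
    intro W hW
    have := MDifferentiableWithinAt.differentiableWithinAt_mpullbackWithin_vectorField
      (s := Set.univ) hW.mdifferentiableWithinAt
    exact this.differentiableAt (by simp)
  -- `V (W κ)` in the chart, by the product rule.
  have key : ∀ {V W : ∀ x : M, TangentSpace 𝓘(ℝ, E) x}, DiffFieldAt E W x →
      mvfderiv 𝓘(ℝ, E) (fun y => mvfderiv 𝓘(ℝ, E) κ y (W y)) x (V x) =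
        fderiv ℝ (fderiv ℝ (κ ∘ φ.symm)) a (pb V a) (pb W a) +
          fderiv ℝ (κ ∘ φ.symm) a (fderiv ℝ (pb W) a (pb V a)) := by
    intro V W hW
    have h1 := fderiv_comp_extChartAt_symm V hat (hψa ▸ hW.mdifferentiableAt_mvfderiv hκ)
    have h2 : ((fun y => mvfderiv 𝓘(ℝ, E) κ y (W y)) ∘ φ.symm) =ᶠ[nhds a]
        fun e => fderiv ℝ (κ ∘ φ.symm) e (pb W e) := by
      filter_upwards [(isOpen_extChartAt_target x).mem_nhds hat] with e he
      exact (fderiv_comp_extChartAt_symm W he (hκd _)).symm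
    rw [hψa, h2.fderiv_eq, fderiv_clm_apply hdk (hpbd hW)] at h1
    rw [← h1]
    exact add_comm _ _
  have hsymm : IsSymmSndFDerivAt ℝ (κ ∘ φ.symm) a :=
    hk.isSymmSndFDerivAt (by rw [minSmoothness_of_isRCLikeNormedField]; norm_cast)
  rw [key hZ, key hY, hsymm.eq (pb Z a) (pb Y a), add_sub_add_left_eq_sub,
    ← map_sub]
  have h := fderiv_comp_extChartAt_symm (f := κ) (mlieBracket 𝓘(ℝ, E) Y Z) hat (hκd _)
  rw [hψa] at h
  rw [← h]
  congr 1
  have hA := (isInvertible_mfderiv_extChartAt (I := 𝓘(ℝ, E)) (mem_extChartAt_source x)).inverse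
  -- The bracket on `M` is the pullback under `φ` of the bracket in the chart; the derivatives of `φ`
  -- and `φ.symm` at the base point cancel.
  apply hA.injective
  rw [mpullbackWithin_apply]
  have h2 := mfderiv_extChartAt_inverse_comp_mfderivWithin_extChartAT_symm
    (mlieBracket 𝓘(ℝ, E) Y Z x)
  rw [← hφ, ← ha] at h2
  rw [hψa]
  refine h2.trans ?_
  have hs : φ.symm ⁻¹' Set.univ ∩ Set.range 𝓘(ℝ, E) = Set.univ := by simp
  have hb : lieBracketWithin ℝ (pb Y) (pb Z)
      (φ.symm ⁻¹' Set.univ ∩ Set.range 𝓘(ℝ, E)) a =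
        fderiv ℝ (pb Z) a (pb Y a) - fderiv ℝ (pb Y) a (pb Z a) := by
    rw [hs, lieBracketWithin_univ]
    rfl
  rw [← mlieBracketWithin_univ, mlieBracketWithin_apply]
  exact congrArg _ hb

end Calculus

/-! ### Existence and smoothness of gradients -/

theorem contMDiffAt_matrix_det {E : Type*} [NormedAddCommGroup E] [NormedSpace ℝ E]
    {M : Type*} [TopologicalSpace M] [ChartedSpace E M] {n : Type*} [Fintype n] [DecidableEq n]
    {A : M → Matrix n n ℝ} {x : M}
    (hA : ∀ i j, ContMDiffAt 𝓘(ℝ, E) 𝓘(ℝ, ℝ) ∞ (fun y => A y i j) x) :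
    ContMDiffAt 𝓘(ℝ, E) 𝓘(ℝ, ℝ) ∞ (fun y => (A y).det) x := by
  simp only [Matrix.det_apply']
  refine contMDiffAt_finsetSum fun σ _ => contMDiffAt_const.mul ?_
  exact contMDiffAt_finsetProd fun i _ => hA _ _

section Gradient

variable {E : Type*} [NormedAddCommGroup E] [NormedSpace ℝ E]
  {M : Type*} [TopologicalSpace M] [ChartedSpace E M] [IsManifold 𝓘(ℝ, E) ∞ M]

theorem PseudoMetric.contMDiffAt_form (g : PseudoMetric E M)
    {Y Z : ∀ x : M, TangentSpace 𝓘(ℝ, E) x} {x : M}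
    (hY : ContMDiffAt 𝓘(ℝ, E) (𝓘(ℝ, E).prod 𝓘(ℝ, E)) ∞
      (fun y : M => TotalSpace.mk' E (E := TangentSpace 𝓘(ℝ, E)) y (Y y)) x)
    (hZ : ContMDiffAt 𝓘(ℝ, E) (𝓘(ℝ, E).prod 𝓘(ℝ, E)) ∞
      (fun y : M => TotalSpace.mk' E (E := TangentSpace 𝓘(ℝ, E)) y (Z y)) x) :
    ContMDiffAt 𝓘(ℝ, E) 𝓘(ℝ, ℝ) ∞ (fun y => g.form y (Y y) (Z y)) x := by
  have h : ContMDiffAt 𝓘(ℝ, E) (𝓘(ℝ, E).prod 𝓘(ℝ, ℝ)) ∞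
      (fun y : M => TotalSpace.mk' ℝ (E := Bundle.Trivial M ℝ) y (g.form y (Y y) (Z y))) x :=
    ContMDiffAt.clm_bundle_apply₂ (F₁ := E) (F₂ := E) g.contMDiff.contMDiffAt hY hZ
  exact (contMDiffAt_totalSpace.1 h).2

theorem PseudoMetric.mdifferentiableAt_form (g : PseudoMetric E M)
    {Y Z : ∀ x : M, TangentSpace 𝓘(ℝ, E) x} {x : M}
    (hY : DiffFieldAt E Y x) (hZ : DiffFieldAt E Z x) :
    MDifferentiableAt 𝓘(ℝ, E) 𝓘(ℝ, ℝ) (fun y => g.form y (Y y) (Z y)) x := by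
  have h : MDifferentiableAt 𝓘(ℝ, E) (𝓘(ℝ, E).prod 𝓘(ℝ, ℝ))
      (fun y : M => TotalSpace.mk' ℝ (E := Bundle.Trivial M ℝ) y (g.form y (Y y) (Z y))) x :=
    MDifferentiableAt.clm_bundle_apply₂ (F₁ := E) (F₂ := E)
      (g.contMDiff.contMDiffAt.mdifferentiableAt (by simp)) hY hZ
  exact ((mdifferentiableAt_totalSpace _ _).1 h).2

theorem PseudoMetric.exists_form_eq [FiniteDimensional ℝ E] (g : PseudoMetric E M) (x : M)
    (α : TangentSpace 𝓘(ℝ, E) x →L[ℝ] ℝ) : ∃ v, g.form x v = α := by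
  have : FiniteDimensional ℝ (TangentSpace 𝓘(ℝ, E) x) := inferInstanceAs (FiniteDimensional ℝ E)
  let f : TangentSpace 𝓘(ℝ, E) x →ₗ[ℝ] Module.Dual ℝ (TangentSpace 𝓘(ℝ, E) x) :=
    ContinuousLinearMap.coeLM ℝ ∘ₗ (g.form x).toLinearMap
  have hf : Function.Injective f := by
    refine (injective_iff_map_eq_zero f).2 fun v hv => g.nondegenerate x v fun w => ?_
    exact LinearMap.congr_fun hv w
  have hs : Function.Surjective f :=
    (LinearMap.injective_iff_surjective_of_finrank_eq_finrank Subspace.dual_finrank_eq.symm).1 hf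
  obtain ⟨v, hv⟩ := hs α
  exact ⟨v, ContinuousLinearMap.ext fun w => LinearMap.congr_fun hv w⟩

/-- A gradient is smooth: in a local frame its coefficients solve a linear system whose matrix is
the Gram matrix of the metric, so Cramer's rule writes them as quotients of smooth determinants. -/
theorem IsGradient.smoothField [FiniteDimensional ℝ E] {g : PseudoMetric E M} {κ : M → ℝ}
    (hκ : ContMDiff 𝓘(ℝ, E) 𝓘(ℝ, ℝ) ∞ κ) {X : ∀ x : M, TangentSpace 𝓘(ℝ, E) x}
    (hX : IsGradient g κ X) : SmoothField E X := by
  intro x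
  let e := trivializationAt E (TangentSpace 𝓘(ℝ, E) : M → Type _) x
  let b := Module.finBasis ℝ E
  have hx : x ∈ e.baseSet := FiberBundle.mem_baseSet_trivializationAt' x
  have hfr := e.isLocalFrameOn_localFrame_baseSet 𝓘(ℝ, E) ∞ b
  set s := e.localFrame b
  have hsm : ∀ i, ContMDiffAt 𝓘(ℝ, E) (𝓘(ℝ, E).prod 𝓘(ℝ, E)) ∞
      (fun y : M => TotalSpace.mk' E (E := TangentSpace 𝓘(ℝ, E)) y (s i y)) x :=
    fun i => hfr.contMDiffAt e.open_baseSet hx i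
  let G : M → Matrix (Fin (Module.finrank ℝ E)) (Fin (Module.finrank ℝ E)) ℝ :=
    fun y => Matrix.of fun i j => g.form y (s i y) (s j y)
  let α : M → Fin (Module.finrank ℝ E) → ℝ := fun y i => mvfderiv 𝓘(ℝ, E) κ y (s i y)
  let c : M → Fin (Module.finrank ℝ E) → ℝ := fun y i => hfr.coeff i y (X y)
  have hG : ∀ i j, ContMDiffAt 𝓘(ℝ, E) 𝓘(ℝ, ℝ) ∞ (fun y => G y i j) x :=
    fun i j => g.contMDiffAt_form (hsm i) (hsm j)
  have hα : ∀ i, ContMDiffAt 𝓘(ℝ, E) 𝓘(ℝ, ℝ) ∞ (fun y => α y i) x :=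
    fun i => contMDiffAt_mvfderiv_apply hκ (hsm i)
  -- A null vector of the Gram matrix would be a vector orthogonal to the whole tangent space.
  have hdet : ∀ y ∈ e.baseSet, (G y).det ≠ 0 := by
    intro y hy h0
    obtain ⟨w, hw0, hw⟩ := Matrix.exists_mulVec_eq_zero_iff.2 h0
    have hli := hfr.linearIndependent hy
    have hgs : ∀ i, g.form y (s i y) (∑ j, w j • s j y) = 0 := by
      intro i
      have := congrFun hw i
      simpa [Matrix.mulVec, dotProduct, G, mul_comm] using this
    have hz : ∑ j, w j • s j y = 0 := by
      refine g.nondegenerate y _ fun u => ?_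
      rw [← (hfr.toBasisAt hy).sum_repr u, map_sum]
      refine Finset.sum_eq_zero fun i _ => ?_
      rw [g.symm, hfr.toBasisAt_coe, map_smul, smul_apply, hgs, smul_zero]
    exact hw0 (funext fun j => Fintype.linearIndependent_iff.1 hli w hz j)
  have hGc : ∀ y ∈ e.baseSet, (G y).mulVec (c y) = α y := by
    intro y hy
    ext i
    have h1 := hfr.coeff_sum_eq X hy
    have h2 : α y i = g.form y (X y) (s i y) := by rw [hX y]
    rw [h2, g.symm, h1, map_sum]
    simp [Matrix.mulVec, dotProduct, G, c, mul_comm]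
  refine hfr.contMDiffAt_of_coeff (fun i => ?_) (e.open_baseSet.mem_nhds hx)
  have hcr : ∀ y ∈ e.baseSet, c y i = ((G y).det)⁻¹ * ((G y).updateCol i (α y)).det := by
    intro y hy
    rw [← Matrix.cramer_apply, ← hGc y hy, Matrix.cramer_eq_adjugate_mulVec, Matrix.mulVec_mulVec,
      Matrix.adjugate_mul, Matrix.smul_mulVec, Matrix.one_mulVec, Pi.smul_apply, smul_eq_mul,
      inv_mul_cancel_left₀ (hdet y hy)]
  have hsmooth : ContMDiffAt 𝓘(ℝ, E) 𝓘(ℝ, ℝ) ∞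
      (fun y => ((G y).det)⁻¹ * ((G y).updateCol i (α y)).det) x := by
    refine ((contMDiffAt_matrix_det hG).inv₀ (hdet x hx)).mul (contMDiffAt_matrix_det fun j k => ?_)
    by_cases h : k = i
    · subst h
      simpa using hα j
    · simpa [Matrix.updateCol_apply, h] using hG j k
  refine hsmooth.congr_of_eventuallyEq ?_
  filter_upwards [e.open_baseSet.mem_nhds hx] with y hy
  exact hcr y hy

theorem PseudoMetric.exists_isGradient [FiniteDimensional ℝ E] (g : PseudoMetric E M) {κ : M → ℝ}
    (hκ : ContMDiff 𝓘(ℝ, E) 𝓘(ℝ, ℝ) ∞ κ) :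
    ∃ X : ∀ x : M, TangentSpace 𝓘(ℝ, E) x, SmoothField E X ∧ IsGradient g κ X := by
  choose X hX using fun x => g.exists_form_eq x (mvfderiv 𝓘(ℝ, E) κ x)
  exact ⟨X, IsGradient.smoothField hκ hX, hX⟩

end Gradient

/-! ### The complex structures -/

section LeviCivita

variable {E : Type*} [NormedAddCommGroup E] [NormedSpace ℝ E]
  {M : Type*} [TopologicalSpace M] [ChartedSpace E M] [IsManifold 𝓘(ℝ, E) ∞ M]
  {g : PseudoMetric E M}
  {cov : CovariantDerivative 𝓘(ℝ, E) E (TangentSpace 𝓘(ℝ, E) : M → Type _)}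

theorem SmoothField.diffFieldAt {X : ∀ x : M, TangentSpace 𝓘(ℝ, E) x} (hX : SmoothField E X)
    (x : M) : DiffFieldAt E X x :=
  hX.contMDiffAt.mdifferentiableAt (by simp)

theorem Hyperkahler.diffFieldAt_J (hk : Hyperkahler g cov) (i : Fin 3)
    {Y : ∀ x : M, TangentSpace 𝓘(ℝ, E) x} {x : M} (hY : DiffFieldAt E Y x) :
    DiffFieldAt E (fun y => hk.J i y (Y y)) x :=
  MDifferentiableAt.clm_bundle_apply (F₁ := E) (F₂ := E)
    ((hk.contMDiff i).contMDiffAt.mdifferentiableAt (by simp)) hY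

theorem Hyperkahler.smoothField_J (hk : Hyperkahler g cov) (i : Fin 3)
    {Y : ∀ x : M, TangentSpace 𝓘(ℝ, E) x} (hY : SmoothField E Y) :
    SmoothField E (fun y => hk.J i y (Y y)) :=
  ContMDiff.clm_bundle_apply (F₁ := E) (F₂ := E) (hk.contMDiff i) hY

theorem exists_diffFieldAt_eq [FiniteDimensional ℝ E] {x : M} (v : TangentSpace 𝓘(ℝ, E) x) :
    ∃ Y : ∀ y : M, TangentSpace 𝓘(ℝ, E) y, DiffFieldAt E Y x ∧ Y x = v :=
  ⟨FiberBundle.extend E v, FiberBundle.mdifferentiableAt_extend .., by simp⟩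

theorem PseudoMetric.eq_of_form_eq (g : PseudoMetric E M) {x : M} {v w : TangentSpace 𝓘(ℝ, E) x}
    (h : ∀ u, g.form x v u = g.form x w u) : v = w :=
  sub_eq_zero.1 <| g.nondegenerate x _ fun u => by rw [map_sub, sub_apply, h, sub_self]

theorem Hyperkahler.J_J (hk : Hyperkahler g cov) (i : Fin 3) (x : M) (v : TangentSpace 𝓘(ℝ, E) x) :
    hk.J i x (hk.J i x v) = -v := by
  rw [hk.quaternionic]
  fin_cases i <;> simp [epsilon, delta]

/-- Each `I_i` is skew for the metric. -/
theorem Hyperkahler.form_J (hk : Hyperkahler g cov) (i : Fin 3) (x : M)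
    (v w : TangentSpace 𝓘(ℝ, E) x) :
    g.form x (hk.J i x v) w = -g.form x v (hk.J i x w) := by
  rw [← hk.hermitian i x v, hk.J_J]
  simp

/-- A self-adjoint endomorphism `A` with `g (A v, I_i w) - g (A w, I_i v) = 2 g (v, I_i w)` for all
`i` is the identity. Put `H (v, w) = g (A v, w)` and write `H_i` for `H (I_i ·, I_i ·)`; replacing `w`
by `I_i w` turns the hypothesis into `H + H_i = 2 g`. Transporting the equation for `I_1` by `I_2`
gives `H_2 + H_3 = 2 g`, and subtracting it from the sum of the equations for `I_2` and `I_3` leaves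
`H = g`. -/
theorem Hyperkahler.eq_self_of_skew_eq (hk : Hyperkahler g cov) {x : M}
    {A : TangentSpace 𝓘(ℝ, E) x →L[ℝ] TangentSpace 𝓘(ℝ, E) x}
    (hA : ∀ v w, g.form x (A v) w = g.form x (A w) v)
    (h : ∀ i v w, g.form x (A v) (hk.J i x w) - g.form x (A w) (hk.J i x v) =
      2 * g.form x v (hk.J i x w)) (v : TangentSpace 𝓘(ℝ, E) x) : A v = v := by
  have h' : ∀ i v w, g.form x (A v) w + g.form x (A (hk.J i x v)) (hk.J i x w) =
      2 * g.form x v w := by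
    intro i v w
    have := h i v (hk.J i x w)
    rw [hk.J_J, map_neg, map_neg, hA (hk.J i x w)] at this
    linarith
  refine g.eq_of_form_eq fun w => ?_
  have hJ : ∀ u, hk.J 0 x (hk.J 1 x u) = hk.J 2 x u := fun u => by
    rw [hk.quaternionic]; simp [epsilon, delta]
  -- The indices are `0, 1, 2` here.
  have h0 := h' 0 (hk.J 1 x v) (hk.J 1 x w)
  rw [hJ, hJ, hk.hermitian] at h0
  linarith [h' 1 v w, h' 2 v w]

/-! ### The contracted equations for the Kähler forms -/

/-- The contracted equations already force `X` to be the gradient of `κ`. -/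
theorem Hyperkahler.isGradient_of_omega_eq (hk : Hyperkahler g cov) {κ : M → ℝ}
    {X : ∀ x : M, TangentSpace 𝓘(ℝ, E) x} {Xi : Fin 3 → ∀ x : M, TangentSpace 𝓘(ℝ, E) x}
    (h : ∀ (i j : Fin 3) (x : M), hk.omega j x (Xi i x) =
      (∑ k, epsilon i j k • hk.omega k x (X x)) - delta i j • mvfderiv 𝓘(ℝ, E) κ x) :
    IsGradient g κ X := by
  intro x
  ext w
  -- The equations for `(i, j) = (0, 1)` and `(0, 0)` suffice: they read
  -- `g (X_0, I_1 w) = g (X, I_2 w)` and `g (X_0, I_0 w) = -dκ w`, and `I_0 = I_1 I_2`.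
  have h01 : ∀ w, g.form x (Xi 0 x) (hk.J 1 x w) = g.form x (X x) (hk.J 2 x w) := fun w => by
    simpa [epsilon, delta, Fin.sum_univ_three, hk.omega_apply] using DFunLike.congr_fun (h 0 1 x) w
  have h00 : ∀ w, g.form x (Xi 0 x) (hk.J 0 x w) = -mvfderiv 𝓘(ℝ, E) κ x w := fun w => by
    simpa [epsilon, delta, Fin.sum_univ_three, hk.omega_apply] using DFunLike.congr_fun (h 0 0 x) w
  have hJ : hk.J 1 x (hk.J 2 x w) = hk.J 0 x w := by
    rw [hk.quaternionic]; simp [epsilon, delta]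
  have h1 := h01 (hk.J 2 x w)
  rw [hJ, h00, hk.J_J, map_neg, neg_inj] at h1
  exact h1.symm

/-- For a gradient field `X`, the fields `X_i = -I_i X` solve the contracted equations. -/
theorem Hyperkahler.omega_neg_J (hk : Hyperkahler g cov) {κ : M → ℝ}
    {X : ∀ x : M, TangentSpace 𝓘(ℝ, E) x} (hgrad : IsGradient g κ X) (i j : Fin 3) (x : M) :
    hk.omega j x (-hk.J i x (X x)) =
      (∑ k, epsilon i j k • hk.omega k x (X x)) - delta i j • mvfderiv 𝓘(ℝ, E) κ x := by
  ext w
  rw [hk.omega_apply, map_neg, neg_apply, hk.form_J, neg_neg, hk.quaternionic, ← hgrad x]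
  simp [hk.omega_apply]

/-! ### The covariant derivative of a gradient -/

variable [FiniteDimensional ℝ E]

theorem IsLeviCivita.mlieBracket_eq (hcov : IsLeviCivita g cov)
    {Y Z : ∀ x : M, TangentSpace 𝓘(ℝ, E) x} {x : M}
    (hY : DiffFieldAt E Y x) (hZ : DiffFieldAt E Z x) :
    VectorField.mlieBracket 𝓘(ℝ, E) Y Z x = cov Z x (Y x) - cov Y x (Z x) := by
  have : CompleteSpace E := FiniteDimensional.complete ℝ E
  exact (cov.torsion_eq_zero_iff.1 hcov.torsion_free hY hZ).symm

theorem IsLeviCivita.hessian_symm (hcov : IsLeviCivita g cov) {κ : M → ℝ}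
    (hκ : ContMDiff 𝓘(ℝ, E) 𝓘(ℝ, ℝ) ∞ κ) {Y Z : ∀ x : M, TangentSpace 𝓘(ℝ, E) x} {x : M}
    (hY : DiffFieldAt E Y x) (hZ : DiffFieldAt E Z x) :
    hessian cov κ Y Z x = hessian cov κ Z Y x := by
  have : CompleteSpace E := FiniteDimensional.complete ℝ E
  have h := mvfderiv_mlieBracket hκ hY hZ
  rw [hcov.mlieBracket_eq hY hZ, map_sub] at h
  unfold hessian
  linarith

/-- If `X` is the gradient of `κ`, then `∇²κ (Y, Z) = g (∇_Y X, Z)`. -/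
theorem IsLeviCivita.hessian_eq (hcov : IsLeviCivita g cov) {κ : M → ℝ}
    {X Y Z : ∀ x : M, TangentSpace 𝓘(ℝ, E) x} {x : M} (hgrad : IsGradient g κ X)
    (hX : DiffFieldAt E X x) (hZ : DiffFieldAt E Z x) :
    hessian cov κ Y Z x = g.form x (cov X x (Y x)) (Z x) := by
  unfold hessian
  simp only [← hgrad _]
  rw [hcov.metric X Z x hX hZ]
  ring

/-- For a gradient field `X`, the endomorphism `v ↦ ∇_v X` is self-adjoint for the metric. -/
theorem IsLeviCivita.form_cov_gradient_symm (hcov : IsLeviCivita g cov) {κ : M → ℝ}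
    (hκ : ContMDiff 𝓘(ℝ, E) 𝓘(ℝ, ℝ) ∞ κ) {X : ∀ x : M, TangentSpace 𝓘(ℝ, E) x}
    (hX : SmoothField E X) (hgrad : IsGradient g κ X) (x : M) (v w : TangentSpace 𝓘(ℝ, E) x) :
    g.form x (cov X x v) w = g.form x (cov X x w) v := by
  obtain ⟨Y, hY, rfl⟩ := exists_diffFieldAt_eq v
  obtain ⟨Z, hZ, rfl⟩ := exists_diffFieldAt_eq w
  rw [← hcov.hessian_eq hgrad (hX.diffFieldAt x) hZ, ← hcov.hessian_eq hgrad (hX.diffFieldAt x) hY,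
    hcov.hessian_symm hκ hY hZ]

theorem IsLeviCivita.lieDeriv_form (hcov : IsLeviCivita g cov)
    {X Y Z : ∀ x : M, TangentSpace 𝓘(ℝ, E) x} {x : M} (hX : DiffFieldAt E X x)
    (hY : DiffFieldAt E Y x) (hZ : DiffFieldAt E Z x) :
    lieDeriv X g.form Y Z x =
      g.form x (cov X x (Y x)) (Z x) + g.form x (Y x) (cov X x (Z x)) := by
  unfold lieDeriv
  rw [hcov.metric Y Z x hY hZ, hcov.mlieBracket_eq hX hY, hcov.mlieBracket_eq hX hZ]
  simp only [map_sub, sub_apply]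
  ring

theorem IsLeviCivita.lieDeriv_omega (hcov : IsLeviCivita g cov) (hk : Hyperkahler g cov) (i : Fin 3)
    {X Y Z : ∀ x : M, TangentSpace 𝓘(ℝ, E) x} {x : M} (hX : DiffFieldAt E X x)
    (hY : DiffFieldAt E Y x) (hZ : DiffFieldAt E Z x) :
    lieDeriv X (hk.omega i) Y Z x =
      hk.omega i x (cov X x (Y x)) (Z x) + hk.omega i x (Y x) (cov X x (Z x)) := by
  unfold lieDeriv
  simp only [hk.omega_apply]
  rw [hcov.metric Y (fun y => hk.J i y (Z y)) x hY (hk.diffFieldAt_J i hZ), hk.parallel i Z x hZ,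
    hcov.mlieBracket_eq hX hY, hcov.mlieBracket_eq hX hZ]
  simp only [map_sub, sub_apply]
  ring

theorem IsLeviCivita.extDerivOne_comp_J (hcov : IsLeviCivita g cov) (hk : Hyperkahler g cov)
    (i : Fin 3) (κ : M → ℝ) {Y Z : ∀ x : M, TangentSpace 𝓘(ℝ, E) x} {x : M}
    (hY : DiffFieldAt E Y x) (hZ : DiffFieldAt E Z x) :
    extDerivOne (fun y => (mvfderiv 𝓘(ℝ, E) κ y).comp (hk.J i y)) Y Z x =
      hessian cov κ Y (fun y => hk.J i y (Z y)) x - hessian cov κ Z (fun y => hk.J i y (Y y)) x := by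
  unfold extDerivOne hessian
  rw [hk.parallel i Z x hZ, hk.parallel i Y x hY, hcov.mlieBracket_eq hY hZ]
  simp only [ContinuousLinearMap.comp_apply, map_sub]
  ring

/-! ### The Euler condition for a gradient field -/

/-- A homothetic Euler field is the gradient of `½ g (X, X)`, since
`Y (g (X, X)) = 2 g (∇_Y X, X) = 2 g (Y, X)`. -/
theorem IsLeviCivita.isGradient_of_isHomotheticEuler (hcov : IsLeviCivita g cov)
    {X : ∀ x : M, TangentSpace 𝓘(ℝ, E) x} (hX : SmoothField E X) (he : IsHomotheticEuler cov X) :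
    ContMDiff 𝓘(ℝ, E) 𝓘(ℝ, ℝ) ∞ (fun y => (1 / 2 : ℝ) * g.form y (X y) (X y)) ∧
      IsGradient g (fun y => (1 / 2 : ℝ) * g.form y (X y) (X y)) X := by
  refine ⟨fun x => contMDiffAt_const.mul (g.contMDiffAt_form (hX x) (hX x)), fun x => ?_⟩
  ext v
  rw [mvfderiv_fun_mul mdifferentiableAt_const
    (g.mdifferentiableAt_form (hX.diffFieldAt x) (hX.diffFieldAt x)), mvfderiv_const]
  have h := hcov.metric X X x (hX.diffFieldAt x) (hX.diffFieldAt x) v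
  rw [he x v, g.symm x v] at h
  simp [h]
  ring

theorem IsLeviCivita.isHomotheticEuler_iff_hessian (hcov : IsLeviCivita g cov) {κ : M → ℝ}
    {X : ∀ x : M, TangentSpace 𝓘(ℝ, E) x} (hX : SmoothField E X) (hgrad : IsGradient g κ X) :
    IsHomotheticEuler cov X ↔ ∀ (Y Z : ∀ x : M, TangentSpace 𝓘(ℝ, E) x) (x : M),
      DiffFieldAt E Y x → DiffFieldAt E Z x →
        g.form x (Y x) (Z x) = hessian cov κ Y Z x := by
  constructor
  · intro h Y Z x _ hZ
    rw [hcov.hessian_eq hgrad (hX.diffFieldAt x) hZ, h]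
  · intro h x v
    refine g.eq_of_form_eq fun w => ?_
    obtain ⟨Y, hY, rfl⟩ := exists_diffFieldAt_eq v
    obtain ⟨Z, hZ, rfl⟩ := exists_diffFieldAt_eq w
    rw [h Y Z x hY hZ, hcov.hessian_eq hgrad (hX.diffFieldAt x) hZ]

theorem IsLeviCivita.isHomotheticEuler_iff_lieDeriv (hcov : IsLeviCivita g cov) {κ : M → ℝ}
    (hκ : ContMDiff 𝓘(ℝ, E) 𝓘(ℝ, ℝ) ∞ κ) {X : ∀ x : M, TangentSpace 𝓘(ℝ, E) x}
    (hX : SmoothField E X) (hgrad : IsGradient g κ X) :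
    IsHomotheticEuler cov X ↔ LieDerivEqTwice X g.form := by
  constructor
  · intro h Y Z x hY hZ
    rw [hcov.lieDeriv_form (hX.diffFieldAt x) hY hZ, h, h, two_mul]
  · intro h x v
    refine g.eq_of_form_eq fun w => ?_
    obtain ⟨Y, hY, rfl⟩ := exists_diffFieldAt_eq v
    obtain ⟨Z, hZ, rfl⟩ := exists_diffFieldAt_eq w
    have h1 := h Y Z x hY hZ
    rw [hcov.lieDeriv_form (hX.diffFieldAt x) hY hZ, g.symm x (Y x),
      hcov.form_cov_gradient_symm hκ hX hgrad x (Z x)] at h1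
    linarith

theorem IsLeviCivita.isHomotheticEuler_iff_isPotential (hcov : IsLeviCivita g cov)
    (hk : Hyperkahler g cov) {κ : M → ℝ}
    (hκ : ContMDiff 𝓘(ℝ, E) 𝓘(ℝ, ℝ) ∞ κ) {X : ∀ x : M, TangentSpace 𝓘(ℝ, E) x}
    (hX : SmoothField E X) (hgrad : IsGradient g κ X) :
    IsHomotheticEuler cov X ↔ hk.IsPotential κ := by
  have key : ∀ (i : Fin 3) (Y Z : ∀ x : M, TangentSpace 𝓘(ℝ, E) x) (x : M),
      DiffFieldAt E Y x → DiffFieldAt E Z x →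
      extDerivOne (fun y => (mvfderiv 𝓘(ℝ, E) κ y).comp (hk.J i y)) Y Z x =
        g.form x (cov X x (Y x)) (hk.J i x (Z x)) - g.form x (cov X x (Z x)) (hk.J i x (Y x)) := by
    intro i Y Z x hY hZ
    rw [hcov.extDerivOne_comp_J hk i κ hY hZ,
      hcov.hessian_eq hgrad (hX.diffFieldAt x) (hk.diffFieldAt_J i hZ),
      hcov.hessian_eq hgrad (hX.diffFieldAt x) (hk.diffFieldAt_J i hY)]
  constructor
  · intro h i Y Z x hY hZ
    rw [key i Y Z x hY hZ, h, h, g.symm x (Z x), hk.form_J, hk.omega_apply]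
    ring
  · intro h x
    refine hk.eq_self_of_skew_eq (hcov.form_cov_gradient_symm hκ hX hgrad x) fun i v w => ?_
    obtain ⟨Y, hY, rfl⟩ := exists_diffFieldAt_eq v
    obtain ⟨Z, hZ, rfl⟩ := exists_diffFieldAt_eq w
    rw [← key i Y Z x hY hZ, ← hk.omega_apply, h i Y Z x hY hZ]
    ring

theorem IsLeviCivita.isHomotheticEuler_iff_lieDeriv_omega (hcov : IsLeviCivita g cov)
    (hk : Hyperkahler g cov) {κ : M → ℝ}
    (hκ : ContMDiff 𝓘(ℝ, E) 𝓘(ℝ, ℝ) ∞ κ) {X : ∀ x : M, TangentSpace 𝓘(ℝ, E) x}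
    (hX : SmoothField E X) (hgrad : IsGradient g κ X) :
    IsHomotheticEuler cov X ↔ ∀ i, LieDerivEqTwice X (hk.omega i) := by
  constructor
  · intro h i Y Z x hY hZ
    rw [hcov.lieDeriv_omega hk i (hX.diffFieldAt x) hY hZ, h, h, two_mul]
  · intro h x
    refine hk.eq_self_of_skew_eq (hcov.form_cov_gradient_symm hκ hX hgrad x) fun i v w => ?_
    obtain ⟨Y, hY, rfl⟩ := exists_diffFieldAt_eq v
    obtain ⟨Z, hZ, rfl⟩ := exists_diffFieldAt_eq w
    have h1 := h i Y Z x hY hZ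
    rw [hcov.lieDeriv_omega hk i (hX.diffFieldAt x) hY hZ] at h1
    simp only [hk.omega_apply] at h1
    have h2 := hk.form_J i x (cov X x (Z x)) (Y x)
    have h3 := g.symm x (Y x) (hk.J i x (cov X x (Z x)))
    linarith

end LeviCivita

/-! ### Existence statements -/

section Existence

variable {E : Type*} [NormedAddCommGroup E] [NormedSpace ℝ E] [FiniteDimensional ℝ E]
  {M : Type*} [TopologicalSpace M] [ChartedSpace E M] [IsManifold 𝓘(ℝ, E) ∞ M]
  {g : PseudoMetric E M}
  {cov : CovariantDerivative 𝓘(ℝ, E) E (TangentSpace 𝓘(ℝ, E) : M → Type _)}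

theorem exists_isHomotheticEuler_iff_exists_hessian (hcov : IsLeviCivita g cov) :
    (∃ X : ∀ x : M, TangentSpace 𝓘(ℝ, E) x, SmoothField E X ∧ IsHomotheticEuler cov X) ↔
      ∃ κ : M → ℝ, ContMDiff 𝓘(ℝ, E) 𝓘(ℝ, ℝ) ∞ κ ∧
        ∀ (Y Z : ∀ x : M, TangentSpace 𝓘(ℝ, E) x) (x : M),
          DiffFieldAt E Y x → DiffFieldAt E Z x →
            g.form x (Y x) (Z x) = hessian cov κ Y Z x := by
  constructor
  · rintro ⟨X, hX, he⟩
    obtain ⟨hκ, hgrad⟩ := hcov.isGradient_of_isHomotheticEuler hX he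
    exact ⟨_, hκ, (hcov.isHomotheticEuler_iff_hessian hX hgrad).1 he⟩
  · rintro ⟨κ, hκ, h⟩
    obtain ⟨X, hX, hgrad⟩ := g.exists_isGradient hκ
    exact ⟨X, hX, (hcov.isHomotheticEuler_iff_hessian hX hgrad).2 h⟩

theorem exists_isHomotheticEuler_iff_exists_lieDeriv (hcov : IsLeviCivita g cov) :
    (∃ X : ∀ x : M, TangentSpace 𝓘(ℝ, E) x, SmoothField E X ∧ IsHomotheticEuler cov X) ↔
      ∃ (κ : M → ℝ) (X : ∀ x : M, TangentSpace 𝓘(ℝ, E) x),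
        ContMDiff 𝓘(ℝ, E) 𝓘(ℝ, ℝ) ∞ κ ∧ SmoothField E X ∧
          IsGradient g κ X ∧ LieDerivEqTwice X g.form := by
  constructor
  · rintro ⟨X, hX, he⟩
    obtain ⟨hκ, hgrad⟩ := hcov.isGradient_of_isHomotheticEuler hX he
    exact ⟨_, X, hκ, hX, hgrad, (hcov.isHomotheticEuler_iff_lieDeriv hκ hX hgrad).1 he⟩
  · rintro ⟨κ, X, hκ, hX, hgrad, h⟩
    exact ⟨X, hX, (hcov.isHomotheticEuler_iff_lieDeriv hκ hX hgrad).2 h⟩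

theorem exists_isHomotheticEuler_iff_exists_isPotential (hcov : IsLeviCivita g cov)
    (hk : Hyperkahler g cov) :
    (∃ X : ∀ x : M, TangentSpace 𝓘(ℝ, E) x, SmoothField E X ∧ IsHomotheticEuler cov X) ↔
      ∃ κ : M → ℝ, ContMDiff 𝓘(ℝ, E) 𝓘(ℝ, ℝ) ∞ κ ∧ hk.IsPotential κ := by
  constructor
  · rintro ⟨X, hX, he⟩
    obtain ⟨hκ, hgrad⟩ := hcov.isGradient_of_isHomotheticEuler hX he
    exact ⟨_, hκ, (hcov.isHomotheticEuler_iff_isPotential hk hκ hX hgrad).1 he⟩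
  · rintro ⟨κ, hκ, h⟩
    obtain ⟨X, hX, hgrad⟩ := g.exists_isGradient hκ
    exact ⟨X, hX, (hcov.isHomotheticEuler_iff_isPotential hk hκ hX hgrad).2 h⟩

theorem exists_isHomotheticEuler_iff_exists_lieDeriv_omega (hcov : IsLeviCivita g cov)
    (hk : Hyperkahler g cov) :
    (∃ X : ∀ x : M, TangentSpace 𝓘(ℝ, E) x, SmoothField E X ∧ IsHomotheticEuler cov X) ↔
      ∃ (X : ∀ x : M, TangentSpace 𝓘(ℝ, E) x)
        (Xi : Fin 3 → ∀ x : M, TangentSpace 𝓘(ℝ, E) x) (κ : M → ℝ),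
        SmoothField E X ∧ (∀ i, SmoothField E (Xi i)) ∧ ContMDiff 𝓘(ℝ, E) 𝓘(ℝ, ℝ) ∞ κ ∧
          (∀ (i j : Fin 3) (x : M),
            hk.omega j x (Xi i x) =
              (∑ k, epsilon i j k • hk.omega k x (X x)) - delta i j • mvfderiv 𝓘(ℝ, E) κ x) ∧
          ∀ k, LieDerivEqTwice X (hk.omega k) := by
  constructor
  · rintro ⟨X, hX, he⟩
    obtain ⟨hκ, hgrad⟩ := hcov.isGradient_of_isHomotheticEuler hX he
    exact ⟨X, fun i x => -hk.J i x (X x), _, hX, fun i => (hk.smoothField_J i hX).neg_section, hκ,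
      hk.omega_neg_J hgrad, (hcov.isHomotheticEuler_iff_lieDeriv_omega hk hκ hX hgrad).1 he⟩
  · rintro ⟨X, Xi, κ, hX, -, hκ, h, hL⟩
    exact ⟨X, hX, (hcov.isHomotheticEuler_iff_lieDeriv_omega hk hκ hX
      (hk.isGradient_of_omega_eq h)).2 hL⟩

end Existence

end HomotheticEuler

end

theorem proposition2p1
    {E : Type*} [NormedAddCommGroup E] [NormedSpace ℝ E] [FiniteDimensional ℝ E]
    {M : Type*} [TopologicalSpace M] [ChartedSpace E M] [IsManifold 𝓘(ℝ, E) ∞ M]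
    (g : HomotheticEuler.PseudoMetric E M)
    (cov : CovariantDerivative 𝓘(ℝ, E) E (TangentSpace 𝓘(ℝ, E) : M → Type _))
    (hcov : HomotheticEuler.IsLeviCivita g cov) :
    List.TFAE [
      -- (a)
      ∃ X : ∀ x : M, TangentSpace 𝓘(ℝ, E) x,
        HomotheticEuler.SmoothField E X ∧ HomotheticEuler.IsHomotheticEuler cov X,
      -- (b)
      ∃ κ : M → ℝ, ContMDiff 𝓘(ℝ, E) 𝓘(ℝ, ℝ) ∞ κ ∧
        ∀ (Y Z : ∀ x : M, TangentSpace 𝓘(ℝ, E) x) (x : M),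
          HomotheticEuler.DiffFieldAt E Y x → HomotheticEuler.DiffFieldAt E Z x →
            g.form x (Y x) (Z x) = HomotheticEuler.hessian cov κ Y Z x,
      -- (c)
      ∃ (κ : M → ℝ) (X : ∀ x : M, TangentSpace 𝓘(ℝ, E) x),
        ContMDiff 𝓘(ℝ, E) 𝓘(ℝ, ℝ) ∞ κ ∧ HomotheticEuler.SmoothField E X ∧
          HomotheticEuler.IsGradient g κ X ∧ HomotheticEuler.LieDerivEqTwice X g.form] ∧
    ∀ hk : HomotheticEuler.Hyperkahler g cov,
      List.TFAE [
        -- (a)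
        ∃ X : ∀ x : M, TangentSpace 𝓘(ℝ, E) x,
          HomotheticEuler.SmoothField E X ∧ HomotheticEuler.IsHomotheticEuler cov X,
        -- (b)
        ∃ κ : M → ℝ, ContMDiff 𝓘(ℝ, E) 𝓘(ℝ, ℝ) ∞ κ ∧
          ∀ (Y Z : ∀ x : M, TangentSpace 𝓘(ℝ, E) x) (x : M),
            HomotheticEuler.DiffFieldAt E Y x → HomotheticEuler.DiffFieldAt E Z x →
              g.form x (Y x) (Z x) = HomotheticEuler.hessian cov κ Y Z x,
        -- (c)
        ∃ (κ : M → ℝ) (X : ∀ x : M, TangentSpace 𝓘(ℝ, E) x),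
          ContMDiff 𝓘(ℝ, E) 𝓘(ℝ, ℝ) ∞ κ ∧ HomotheticEuler.SmoothField E X ∧
            HomotheticEuler.IsGradient g κ X ∧ HomotheticEuler.LieDerivEqTwice X g.form,
        -- (d)
        ∃ κ : M → ℝ, ContMDiff 𝓘(ℝ, E) 𝓘(ℝ, ℝ) ∞ κ ∧ hk.IsPotential κ,
        -- (e)
        ∃ (X : ∀ x : M, TangentSpace 𝓘(ℝ, E) x)
          (Xi : Fin 3 → ∀ x : M, TangentSpace 𝓘(ℝ, E) x) (κ : M → ℝ),
          HomotheticEuler.SmoothField E X ∧ (∀ i, HomotheticEuler.SmoothField E (Xi i)) ∧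
            ContMDiff 𝓘(ℝ, E) 𝓘(ℝ, ℝ) ∞ κ ∧
            (∀ (i j : Fin 3) (x : M),
              hk.omega j x (Xi i x) =
                (∑ k, HomotheticEuler.epsilon i j k • hk.omega k x (X x))
                  - HomotheticEuler.delta i j • mvfderiv 𝓘(ℝ, E) κ x) ∧
            ∀ k, HomotheticEuler.LieDerivEqTwice X (hk.omega k)] := by
  have hab := HomotheticEuler.exists_isHomotheticEuler_iff_exists_hessian hcov
  have hac := HomotheticEuler.exists_isHomotheticEuler_iff_exists_lieDeriv hcov
  refine ⟨?_, fun hk => ?_⟩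
  · tfae_have 1 ↔ 2 := hab
    tfae_have 1 ↔ 3 := hac
    tfae_finish
  · tfae_have 1 ↔ 2 := hab
    tfae_have 1 ↔ 3 := hac
    tfae_have 1 ↔ 4 :=
      HomotheticEuler.exists_isHomotheticEuler_iff_exists_isPotential hcov hk
    tfae_have 1 ↔ 5 :=
      HomotheticEuler.exists_isHomotheticEuler_iff_exists_lieDeriv_omega hcov hk
    tfae_finish
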